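/- Let $q\ge 6$ be a prime power. A set of points of $\mathrm{PG}(6,q)$ is a non-degenerate conic (respectively, a twisted cubic) if in suitable coordinates of some plane (respectively, some $3$-space) it is $\{(1,\theta,\theta^2)\mid\theta\in\mathbb F_q\cup\{\infty\}\}$ (respectively, $\{(1,\theta,\theta^2,\theta^3)\mid\theta\in\mathbb F_q\cup\{\infty\}\}$), where $\theta=\infty$ gives $(0,0,1)$ (respectively, $(0,0,0,1)$). A projectivity from a non-degenerate conic $\mathcal C$ to a twisted cubic $\mathcal N$ is a map $\phi:\mathcal C\to\mathcal N$ that, in such parameters of $\mathcal C$ and $\mathcal N$, is given by an element of $\mathrm{PGL}(2,q)$. If $\mathcal C$ spans a plane $\alpha$, $\mathcal N$ spans a $3$-space $\Pi_3$, $\alpha\cap\Pi_3=\emptyset$, and $\phi:\mathcal C\to\mathcal N$ is a projectivity, then the scroll of $\mathcal C$, $\mathcal N$ and $\phi$ is the set of all points on the $q+1$ lines $\langle P,\phi(P)\rangle$, $P\in\mathcal C$. It is called a ruled quintic surface, with generators these lines, conic directrix $\mathcal C$ and twisted cubic directrix $\mathcal N$. Let $\mathcal V$ be a ruled quintic surface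 of $\mathrm{PG}(6,q)$, the scroll of $\mathcal C$, $\mathcal N$ and $\phi$ as above. Then $\mathcal V$ contains exactly $q^2$ twisted cubics. Moreover, each twisted cubic $\mathcal T$ contained in $\mathcal V$ is a directrix of $\mathcal V$: the $3$-space spanned by $\mathcal T$ is disjoint from $\alpha$, and there is a projectivity $\psi:\mathcal C\to\mathcal T$ such that $\langle P,\psi(P)\rangle=\langle P,\phi(P)\rangle$ for every $P\in\mathcal C$; so $\mathcal V$ is also the scroll of $\mathcal C$, $\mathcal T$ and $\psi$, with the same generators. -/

import Mathlib

open scoped LinearAlgebra.Projectivization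

namespace QuinticScroll

variable {K : Type*} [Field K] {W : Type*} [AddCommGroup W] [Module K W]

/-- The vector `∑ i, x₀ ^ (n - i) * x₁ ^ i • v i`; if `x = (1, θ)`, this is the vector with
coordinates `(1, θ, θ ^ 2, …, θ ^ n)` with respect to `v 0, …, v n`. -/
def nrcVec {n : ℕ} (v : Fin (n + 1) → W) (x : Fin 2 → K) : W :=
  ∑ i : Fin (n + 1), (x 0 ^ (n - (i : ℕ)) * x 1 ^ (i : ℕ)) • v i

theorem nrcVec_ne_zero {n : ℕ} {v : Fin (n + 1) → W} (hv : LinearIndependent K v)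
    {x : Fin 2 → K} (hx : x ≠ 0) : nrcVec v x ≠ 0 := by
  intro h
  have h' := Fintype.linearIndependent_iff.1 hv _ h
  have h0 : x 0 = 0 := by
    have := h' 0
    by_contra hne
    simp [hne] at this
  have h1 : x 1 = 0 := by
    have := h' (Fin.last n)
    by_contra hne
    simp [hne] at this
  apply hx
  ext i
  fin_cases i
  · exact h0
  · exact h1

theorem nrcVec_smul {n : ℕ} (v : Fin (n + 1) → W) (a : K) (x : Fin 2 → K) :
    nrcVec v (a • x) = a ^ n • nrcVec v x := by
  unfold nrcVec
  rw [Finset.smul_sum]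
  refine Finset.sum_congr rfl fun i _ => ?_
  rw [smul_smul]
  congr 1
  have hi : a ^ n = a ^ (n - (i : ℕ)) * a ^ (i : ℕ) := by
    rw [← pow_add]
    congr 1
    have := i.2
    omega
  rw [hi]
  simp only [Pi.smul_apply, smul_eq_mul, mul_pow]
  ring

/-- The parametrisation `(x₀ : x₁) ↦ (x₀ ^ n : x₀ ^ (n - 1) * x₁ : … : x₁ ^ n)`, in coordinates
with respect to the linearly independent vectors `v 0, …, v n`, of an `n`-dimensional normal
rational curve by the projective line. -/
def nrcPoint {n : ℕ} (v : Fin (n + 1) → W) (hv : LinearIndependent K v) :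
    ℙ K (Fin 2 → K) → ℙ K W :=
  Projectivization.lift
    (fun x => Projectivization.mk K (nrcVec v x.1) (nrcVec_ne_zero hv x.2))
    (by
      rintro ⟨x, hx⟩ ⟨y, hy⟩ t h
      obtain rfl : x = t • y := h
      rw [Projectivization.mk_eq_mk_iff']
      exact ⟨t ^ n, (nrcVec_smul v t y).symm⟩)

/-- `N` is the point set of an `n`-dimensional normal rational curve (it spans a projective
subspace of dimension `n`). -/
def IsNRC (K : Type*) [Field K] {W : Type*} [AddCommGroup W] [Module K W]
    (n : ℕ) (N : Set (ℙ K W)) : Prop :=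
  ∃ (v : Fin (n + 1) → W) (hv : LinearIndependent K v), N = Set.range (nrcPoint v hv)

/-- `C` is a non-degenerate conic, that is `{(1, θ, θ ^ 2) | θ ∈ K ∪ {∞}}` in suitable
coordinates of a plane. -/
def IsConic (C : Set (ℙ K W)) : Prop := IsNRC K 2 C

/-- `N` is a twisted cubic, that is `{(1, θ, θ ^ 2, θ ^ 3) | θ ∈ K ∪ {∞}}` in suitable
coordinates of a `3`-space. -/
def IsTwistedCubic (N : Set (ℙ K W)) : Prop := IsNRC K 3 N

/-- `φ` is a projectivity from the conic `C` to the twisted cubic `N`: in non-homogeneous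
parameters of `C` and of `N` it is an element of `PGL(2, K)`. -/
def IsProjectivity (C N : Set (ℙ K W)) (φ : C → N) : Prop :=
  ∃ (v : Fin 3 → W) (hv : LinearIndependent K v) (w : Fin 4 → W) (hw : LinearIndependent K w)
    (g : Matrix.ProjGenLinGroup (Fin 2) K),
    C = Set.range (nrcPoint (n := 2) v hv) ∧ N = Set.range (nrcPoint (n := 3) w hw) ∧
    ∀ (P : C) (θ : ℙ K (Fin 2 → K)),
      (P : ℙ K W) = nrcPoint (n := 2) v hv θ → (φ P : ℙ K W) = nrcPoint (n := 3) w hw (g • θ)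

/-- The generator through the point `P` of `C`: the line joining `P` to `φ P`, as a set of
points. -/
def generator {C N : Set (ℙ K W)} (φ : C → N) (P : C) : Set (ℙ K W) :=
  (Projectivization.Subspace.span {(P : ℙ K W), (φ P : ℙ K W)} : Projectivization.Subspace K W)

/-- `V` is the scroll with conic directrix `C` and twisted cubic directrix `N`, lying in disjoint
subspaces, that is ruled by the projectivity `φ` from `C` to `N`. In a `6`-dimensional projective
space this is a ruled quintic surface. -/
structure IsScroll (V C N : Set (ℙ K W)) (φ : C → N) : Prop where
  conic : IsConic C
  cubic : IsTwistedCubic N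
  disjoint : Disjoint (Projectivization.Subspace.span C : Set (ℙ K W))
    (Projectivization.Subspace.span N : Set (ℙ K W))
  projectivity : IsProjectivity C N φ
  eq_union : V = ⋃ P : C, generator φ P

end QuinticScroll

/-! After the projectivity is absorbed into the coordinates of the cubic, the conic is `c(x)` and
the cubic `n(x)` for a common binary parameter `x`. Their coefficient vectors form a basis of the
7-dimensional space, and the generator at `x` joins `c(x)` to `n(x)`. For each of the `q ^ 2` binary
linear forms `l`, the cubic `l(x) • c(x) + n(x)` meets every generator off the conic, so it is a
directrix with the same generators; distinct forms give distinct cubics (`cubicCurve_injective`).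

Conversely, let `u(θ)` parametrise a twisted cubic on the scroll. Its conic coordinates are
proportional to `(x², xy, y²)` and its cubic coordinates to `(x³, x²y, xy², y³)` at each `θ`, so
certain 2 × 2 minors of degree at most 6 vanish on all of `K`. Since 6 is not a prime power, `q ≥ 7`
and the minors vanish identically. Hence the coordinates are `a • (p², pq, q²)` and `b • (p³, p²q,
pq², q³)` for polynomials `p, q, a, b` (`exists_conic_cubic_factor`). Degrees leave two cases: `p,
q` constant, which puts the cubic on one line, or `p, q, a` of degree at most 1 and `b` constant,
which after a change of parameter is a cubic of the family (`exists_eq_cubicVec`). -/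

namespace QuinticScroll

/-! ### Normal rational curves: spans, injectivity, change of parameter. -/

section Basic

variable {K : Type*} [Field K] {W : Type*} [AddCommGroup W] [Module K W]

theorem eq_and_eq_of_add_eq_of_disjoint {S T : Submodule K W} (h : Disjoint S T) {a b c d : W}
    (ha : a ∈ S) (hb : b ∈ S) (hc : c ∈ T) (hd : d ∈ T) (e : a + c = b + d) : a = b ∧ c = d := by
  have h' : a - b = d - c := by
    rw [sub_eq_sub_iff_add_eq_add, e, add_comm]
  have h0 : a - b = 0 :=
    Submodule.disjoint_def.1 h _ (sub_mem ha hb) (h' ▸ sub_mem hd hc)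
  exact ⟨sub_eq_zero.1 h0, (sub_eq_zero.1 (h'.symm.trans h0)).symm⟩

theorem nrcPoint_mk {n : ℕ} (v : Fin (n + 1) → W) (hv : LinearIndependent K v) (x : Fin 2 → K)
    (hx : x ≠ 0) : nrcPoint v hv (Projectivization.mk K x hx) =
      Projectivization.mk K (nrcVec v x) (nrcVec_ne_zero hv hx) := rfl

theorem map_nrcVec {W' : Type*} [AddCommGroup W'] [Module K W'] (f : W →ₗ[K] W') {n : ℕ}
    (v : Fin (n + 1) → W) (x : Fin 2 → K) : f (nrcVec v x) = nrcVec (fun i => f (v i)) x := by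
  simp [nrcVec]

/-- A vector valued polynomial of degree less than the number of scalars is determined by its
values. -/
theorem eq_zero_of_nrcVec_eq_zero [Fintype K] {n : ℕ} (hn : n < Fintype.card K)
    {v : Fin (n + 1) → W} (h : ∀ θ : K, nrcVec v ![1, θ] = 0) (i : Fin (n + 1)) : v i = 0 := by
  rw [← Module.forall_dual_apply_eq_zero_iff K]
  intro f
  let p : Polynomial K := ∑ j : Fin (n + 1), Polynomial.monomial (j : ℕ) (f (v j))
  have hp : p = 0 := by
    refine Polynomial.eq_zero_of_natDegree_lt_card_of_eval_eq_zero p Function.injective_id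
      (fun θ => ?_) (lt_of_le_of_lt ?_ hn)
    · have := congrArg f (h θ)
      simpa [nrcVec, p, Polynomial.eval_finsetSum, mul_comm] using this
    · refine Polynomial.natDegree_sum_le_of_forall_le _ _ fun j _ => ?_
      exact (Polynomial.natDegree_monomial_le _).trans (by omega)
  have := congrArg (fun p => Polynomial.coeff p (i : ℕ)) hp
  simpa [p, Polynomial.finsetSum_coeff, Polynomial.coeff_monomial, Fin.val_inj] using this

theorem eq_of_nrcVec_eq [Fintype K] {n : ℕ} (hn : n < Fintype.card K)
    {v w : Fin (n + 1) → W} (h : ∀ θ : K, nrcVec v ![1, θ] = nrcVec w ![1, θ]) : v = w := by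
  ext i
  rw [← sub_eq_zero]
  refine eq_zero_of_nrcVec_eq_zero (v := fun i => v i - w i) hn (fun θ => ?_) i
  have := h θ
  rw [← sub_eq_zero] at this
  simpa [nrcVec, smul_sub] using this

/-- Vanishing modulo `S` at all scalars forces the coefficients to vanish modulo `S`. Thus the
affine points of a curve already span its subspace. -/
theorem mem_of_nrcVec_mem [Fintype K] {n : ℕ} (hn : n < Fintype.card K)
    {v : Fin (n + 1) → W} {S : Submodule K W} (h : ∀ θ : K, nrcVec v ![1, θ] ∈ S)
    (i : Fin (n + 1)) : v i ∈ S := by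
  rw [← Submodule.Quotient.mk_eq_zero, ← Submodule.mkQ_apply]
  refine eq_zero_of_nrcVec_eq_zero (v := fun i => S.mkQ (v i)) hn (fun θ => ?_) i
  rw [← map_nrcVec, Submodule.mkQ_apply, Submodule.Quotient.mk_eq_zero]
  exact h θ

theorem nrcVec_mem_span {n : ℕ} (v : Fin (n + 1) → W) (x : Fin 2 → K) :
    nrcVec v x ∈ Submodule.span K (Set.range v) :=
  Submodule.sum_mem _ fun i _ => Submodule.smul_mem _ _ (Submodule.subset_span ⟨i, rfl⟩)

/-- Bridge from projective spans to linear spans; the later lemmas on spans are linear algebra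
through it. -/
theorem mk_mem_span_iff {S : Set (ℙ K W)} {R : Set W}
    (h₁ : ∀ z hz, Projectivization.mk K z hz ∈ S → z ∈ Submodule.span K R)
    (h₂ : ∀ z ∈ R, ∀ hz, Projectivization.mk K z hz ∈ Projectivization.Subspace.span S)
    {z : W} (hz : z ≠ 0) :
    Projectivization.mk K z hz ∈ Projectivization.Subspace.span S ↔ z ∈ Submodule.span K R := by
  constructor
  · intro h
    have : Projectivization.Subspace.span S ≤ (Submodule.span K R).projectivization := by
      rw [Projectivization.Subspace.span_le_subspace_iff]
      intro P hP
      induction P using Projectivization.ind with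
      | h y hy => exact (Submodule.mk_mem_projectivization_iff _ hy).2 (h₁ y hy hP)
    exact (Submodule.mk_mem_projectivization_iff _ hz).1 (this h)
  · intro h
    rw [← Projectivization.Subspace.mem_submodule_iff]
    refine (Submodule.span_le.2 ?_ : Submodule.span K R ≤ _) h
    intro y hy hy0
    exact h₂ y hy hy0

theorem mk_mem_span_pair_iff {a b z : W} (ha : a ≠ 0) (hb : b ≠ 0) (hz : z ≠ 0) :
    Projectivization.mk K z hz ∈ Projectivization.Subspace.span
      {Projectivization.mk K a ha, Projectivization.mk K b hb} ↔
    ∃ α β : K, α • a + β • b = z := by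
  rw [← Submodule.mem_span_pair]
  refine mk_mem_span_iff ?_ ?_ hz
  · rintro y hy (h | h)
    · obtain ⟨t, rfl⟩ := (Projectivization.mk_eq_mk_iff' _ _ _ _ _).1 h
      exact Submodule.smul_mem _ _ (Submodule.subset_span (by simp))
    · obtain ⟨t, rfl⟩ := (Projectivization.mk_eq_mk_iff' _ _ _ _ _).1 h
      exact Submodule.smul_mem _ _ (Submodule.subset_span (by simp))
  · rintro y (rfl | rfl) hy <;>
      exact Projectivization.Subspace.subset_span _ (by simp)

theorem mk_mem_span_range_nrcPoint_iff [Fintype K] {n : ℕ} (hn : n < Fintype.card K)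
    {v : Fin (n + 1) → W} (hv : LinearIndependent K v) {z : W} (hz : z ≠ 0) :
    Projectivization.mk K z hz ∈ Projectivization.Subspace.span (Set.range (nrcPoint v hv)) ↔
      z ∈ Submodule.span K (Set.range v) := by
  refine mk_mem_span_iff ?_ ?_ hz
  · rintro y hy ⟨P, hP⟩
    induction P using Projectivization.ind with
    | h x hx =>
      obtain ⟨t, rfl⟩ := (Projectivization.mk_eq_mk_iff' _ _ _ _ _).1 hP.symm
      exact Submodule.smul_mem _ _ (nrcVec_mem_span v x)
  · rintro _ ⟨i, rfl⟩ hi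
    rw [← Projectivization.Subspace.mem_submodule_iff]
    refine mem_of_nrcVec_mem hn (fun θ => ?_) i
    intro h0
    exact Projectivization.Subspace.subset_span _
      ⟨Projectivization.mk K ![1, θ] (fun h => one_ne_zero (congrFun h 0)), rfl⟩

theorem disjoint_span_range_nrcPoint_iff [Fintype K] {m n : ℕ} (hm : m < Fintype.card K)
    (hn : n < Fintype.card K) {v : Fin (m + 1) → W} (hv : LinearIndependent K v)
    {w : Fin (n + 1) → W} (hw : LinearIndependent K w) :
    Disjoint
      (Projectivization.Subspace.span (Set.range (nrcPoint v hv)) : Set (ℙ K W))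
      (Projectivization.Subspace.span (Set.range (nrcPoint w hw)) : Set (ℙ K W)) ↔
    LinearIndependent K (Sum.elim v w) := by
  rw [linearIndependent_sum, Set.disjoint_left]
  simp only [Sum.elim_comp_inl, Sum.elim_comp_inr, hv, hw, true_and, Submodule.disjoint_def]
  constructor
  · intro h z hzv hzw
    by_contra hz
    exact h ((mk_mem_span_range_nrcPoint_iff hm hv hz).2 hzv)
      ((mk_mem_span_range_nrcPoint_iff hn hw hz).2 hzw)
  · intro h P hPv hPw
    induction P using Projectivization.ind with
    | h z hz =>
      exact hz (h z ((mk_mem_span_range_nrcPoint_iff hm hv hz).1 hPv)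
        ((mk_mem_span_range_nrcPoint_iff hn hw hz).1 hPw))

theorem nrcVec_eq_nrcVec_coeff {n : ℕ} {v : Fin (n + 1) → W} (hv : LinearIndependent K v)
    {a : K} {x y : Fin 2 → K} (h : nrcVec v x = a • nrcVec v y) (i : Fin (n + 1)) :
    x 0 ^ (n - (i : ℕ)) * x 1 ^ (i : ℕ) = a * (y 0 ^ (n - (i : ℕ)) * y 1 ^ (i : ℕ)) := by
  rw [← sub_eq_zero]
  refine Fintype.linearIndependent_iff.1 hv
    (fun i : Fin (n + 1) => x 0 ^ (n - (i : ℕ)) * x 1 ^ (i : ℕ) -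
      a * (y 0 ^ (n - (i : ℕ)) * y 1 ^ (i : ℕ))) ?_ i
  rw [← sub_eq_zero] at h
  simpa [nrcVec, Finset.smul_sum, sub_smul, mul_smul] using h

/-- The first two coordinates, `x₀ ^ n` and `x₀ ^ (n - 1) * x₁`, already determine the ratio `x₁ /
x₀`; the case `x₀ = 0` forces `y₀ = 0`. -/
theorem det_eq_zero_of_nrcVec_eq_smul {n : ℕ} (hn : n ≠ 0) {v : Fin (n + 1) → W}
    (hv : LinearIndependent K v) {a : K} {x y : Fin 2 → K} (hx : x ≠ 0)
    (h : nrcVec v x = a • nrcVec v y) : x 0 * y 1 = x 1 * y 0 := by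
  have ha : a ≠ 0 := by
    rintro rfl
    exact nrcVec_ne_zero hv hx (by simpa using h)
  have h0 := nrcVec_eq_nrcVec_coeff hv h 0
  obtain ⟨n, rfl⟩ := Nat.exists_eq_succ_of_ne_zero hn
  have h1 := nrcVec_eq_nrcVec_coeff hv h 1
  simp only [Fin.val_zero, Nat.sub_zero, pow_zero, mul_one] at h0
  simp only [Fin.val_one, pow_one, Nat.add_sub_cancel] at h1
  by_cases hx0 : x 0 = 0
  · have : y 0 = 0 := by
      rw [hx0, zero_pow (Nat.succ_ne_zero n)] at h0
      simpa [ha] using h0.symm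
    rw [hx0, this]
    ring
  · apply mul_left_cancel₀ (pow_ne_zero n hx0)
    apply mul_left_cancel₀ ha
    have hy0 : y 0 ≠ 0 := by
      intro hy
      rw [hy, zero_pow (Nat.succ_ne_zero n), mul_zero] at h0
      exact hx0 (by simpa using h0)
    apply mul_left_cancel₀ (pow_ne_zero n hy0)
    rw [Nat.succ_eq_add_one] at h0
    linear_combination a * y 0 ^ n * y 1 * h0 - a * y 0 ^ (n + 1) * h1

theorem nrcPoint_injective {n : ℕ} (hn : n ≠ 0) {v : Fin (n + 1) → W}
    (hv : LinearIndependent K v) : Function.Injective (nrcPoint v hv) := by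
  intro P Q h
  induction P using Projectivization.ind with
  | h x hx =>
    induction Q using Projectivization.ind with
    | h y hy =>
      obtain ⟨t, ht⟩ := (Projectivization.mk_eq_mk_iff' _ _ _ _ _).1 h
      have := det_eq_zero_of_nrcVec_eq_smul hn hv hx ht.symm
      rw [Projectivization.mk_eq_mk_iff']
      by_cases hy0 : y 0 = 0
      · have hy1 : y 1 ≠ 0 := fun h1 => hy (by ext i; fin_cases i <;> simp [hy0, h1])
        refine ⟨x 1 / y 1, ?_⟩
        have hx0 : x 0 = 0 := by simpa [hy0, hy1] using this
        ext i; fin_cases i <;> simp [hy0, hx0, hy1]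
      · refine ⟨x 0 / y 0, ?_⟩
        ext i; fin_cases i
        · simp [hy0]
        · simp only [Fin.mk_one, Pi.smul_apply, smul_eq_mul]
          rw [div_mul_eq_mul_div, this]
          field_simp

theorem exists_eq_mk_nrcVec {n : ℕ} {v : Fin (n + 1) → W} {hv : LinearIndependent K v}
    {P : ℙ K W} (hP : P ∈ Set.range (nrcPoint v hv)) :
    ∃ x, ∃ hx : x ≠ 0, P = Projectivization.mk K (nrcVec v x) (nrcVec_ne_zero hv hx) := by
  obtain ⟨Q, rfl⟩ := hP
  induction Q using Projectivization.ind with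
  | h x hx => exact ⟨x, hx, rfl⟩

/-- The coefficients of the product of three binary linear forms. -/
def mulLinear (a b c : Fin 2 → K) : Fin 4 → K :=
  ![a 0 * b 0 * c 0, a 1 * b 0 * c 0 + a 0 * b 1 * c 0 + a 0 * b 0 * c 1,
    a 0 * b 1 * c 1 + a 1 * b 0 * c 1 + a 1 * b 1 * c 0, a 1 * b 1 * c 1]

theorem nrcVec_two (v : Fin 3 → W) (x : Fin 2 → K) : nrcVec (n := 2) v x =
    (x 0 ^ 2) • v 0 + (x 0 * x 1) • v 1 + (x 1 ^ 2) • v 2 := by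
  have := Fin.sum_univ_three fun i : Fin 3 => (x 0 ^ (2 - (i : ℕ)) * x 1 ^ (i : ℕ)) • v i
  simpa using! this

theorem nrcVec_three (v : Fin 4 → W) (x : Fin 2 → K) : nrcVec (n := 3) v x =
    (x 0 ^ 3) • v 0 + (x 0 ^ 2 * x 1) • v 1 + (x 0 * x 1 ^ 2) • v 2 + (x 1 ^ 3) • v 3 := by
  have := Fin.sum_univ_four fun i : Fin 4 => (x 0 ^ (3 - (i : ℕ)) * x 1 ^ (i : ℕ)) • v i
  simpa using! this

theorem nrcVec_mulLinear_smul (a b c x : Fin 2 → K) (z : W) :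
    nrcVec (n := 3) (fun i => mulLinear a b c i • z) x =
      ((a 0 * x 0 + a 1 * x 1) * (b 0 * x 0 + b 1 * x 1) * (c 0 * x 0 + c 1 * x 1)) • z := by
  simp only [nrcVec, mulLinear, smul_smul, ← Finset.sum_smul]
  congr 1
  simp [Fin.sum_univ_four]
  ring

/-- The coefficients of a twisted cubic after a linear change of the parameter. -/
def nrcComp (w : Fin 4 → W) (A : Matrix (Fin 2) (Fin 2) K) : Fin 4 → W := fun j =>
  mulLinear (A 0) (A 0) (A 0) j • w 0 + mulLinear (A 0) (A 0) (A 1) j • w 1 +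
    mulLinear (A 0) (A 1) (A 1) j • w 2 + mulLinear (A 1) (A 1) (A 1) j • w 3

theorem nrcVec_add {n : ℕ} (v w : Fin (n + 1) → W) (x : Fin 2 → K) :
    nrcVec (fun i => v i + w i) x = nrcVec v x + nrcVec w x := by
  simp [nrcVec, Finset.sum_add_distrib]

theorem nrcVec_nrcComp (w : Fin 4 → W) (A : Matrix (Fin 2) (Fin 2) K) (x : Fin 2 → K) :
    nrcVec (n := 3) (nrcComp w A) x = nrcVec (n := 3) w (A.mulVec x) := by
  unfold nrcComp
  rw [nrcVec_add (n := 3), nrcVec_add (n := 3), nrcVec_add (n := 3)]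
  simp only [nrcVec_mulLinear_smul]
  rw [nrcVec_three w]
  simp only [Matrix.mulVec, dotProduct, Fin.sum_univ_two]
  module

/-- Evaluating the new curve at `A⁻¹ x` recovers the old one, so the new coefficients span at least
the old 4-dimensional space. -/
theorem linearIndependent_nrcComp [Fintype K] (hq : 3 < Fintype.card K) {w : Fin 4 → W}
    (hw : LinearIndependent K w) (A : Matrix.GeneralLinearGroup (Fin 2) K) :
    LinearIndependent K (nrcComp w A.1) := by
  have hle : Submodule.span K (Set.range w) ≤ Submodule.span K (Set.range (nrcComp w A.1)) := by
    rw [Submodule.span_le]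
    rintro _ ⟨i, rfl⟩
    refine mem_of_nrcVec_mem (n := 3) hq (fun θ => ?_) i
    have := nrcVec_mem_span (n := 3) (nrcComp w A.1) (A⁻¹.1.mulVec ![1, θ])
    rwa [nrcVec_nrcComp, Matrix.mulVec_mulVec, ← Units.val_mul, mul_inv_cancel,
      Units.val_one, Matrix.one_mulVec] at this
  rw [linearIndependent_iff_card_le_finrank_span, Set.finrank, ← finrank_span_eq_card hw]
  have : FiniteDimensional K (Submodule.span K (Set.range (nrcComp w A.1))) :=
    FiniteDimensional.span_of_finite K (Set.finite_range _)
  exact Submodule.finrank_mono hle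

end Basic

/-! ### Polynomial families lying on the scroll. -/

section Polynomial

open Polynomial

variable {K : Type*} [Field K]

theorem seven_le_card [Fintype K] (hq : 6 ≤ Fintype.card K) : 7 ≤ Fintype.card K := by
  refine lt_of_le_of_ne hq fun h => ?_
  have h6 : IsPrimePow 6 := h ▸ FiniteField.isPrimePow_card K
  have := (Nat.Coprime.isPrimePow_dvd_mul (a := 2) (b := 3) (by norm_num) h6).1 (by norm_num)
  omega

/-- Two families of polynomials of small degree that are proportional at every scalar have a common
ratio. -/
theorem exists_isCoprime_ratio [Fintype K] (hq : 7 ≤ Fintype.card K) {ι : Type*} (r s : ι → K[X])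
    (hr : ∀ i, (r i).natDegree ≤ 3) (hs : ∀ i, (s i).natDegree ≤ 3)
    (h : ∀ θ : K, ∃ (x y : K) (m : ι → K), ∀ i, (r i).eval θ = x * m i ∧ (s i).eval θ = y * m i) :
    ∃ (p q : K[X]) (m : ι → K[X]), IsCoprime p q ∧ ∀ i, r i = p * m i ∧ s i = q * m i := by
  -- The minors have degree at most 6 and vanish at all of the at least 7 scalars.
  have hminor : ∀ i j, r i * s j = s i * r j := by
    intro i j
    rw [← sub_eq_zero]
    refine eq_zero_of_natDegree_lt_card_of_eval_eq_zero _ Function.injective_id (fun θ => ?_)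
      (lt_of_le_of_lt (b := 6) ?_ hq)
    · obtain ⟨x, y, m, hm⟩ := h θ
      simp only [id, eval_sub, eval_mul, (hm i).1, (hm i).2, (hm j).1, (hm j).2]
      ring
    · refine (natDegree_sub_le _ _).trans (max_le ?_ ?_)
      · exact natDegree_mul_le.trans (by have := hr i; have := hs j; omega)
      · exact natDegree_mul_le.trans (by have := hr j; have := hs i; omega)
  classical
  by_cases h0 : ∀ i, r i = 0 ∧ s i = 0
  · exact ⟨1, 1, 0, isCoprime_one_left, fun i => by simp [h0 i]⟩
  · push Not at h0
    obtain ⟨k, hk⟩ := h0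
    have hcop : ∃ g p q : K[X], g ≠ 0 ∧ IsCoprime p q ∧ r k = g * p ∧ s k = g * q := by
      by_cases hrk : r k = 0
      · exact ⟨s k, 0, 1, hk hrk, isCoprime_one_right, by simp [hrk], by simp⟩
      · have hg : EuclideanDomain.gcd (r k) (s k) ≠ 0 := fun hg =>
          hrk (EuclideanDomain.gcd_eq_zero_iff.1 hg).1
        obtain ⟨p, hp⟩ := EuclideanDomain.gcd_dvd_left (r k) (s k)
        obtain ⟨q, hq⟩ := EuclideanDomain.gcd_dvd_right (r k) (s k)
        refine ⟨_, p, q, hg, ?_, hp, hq⟩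
        refine ⟨EuclideanDomain.gcdA (r k) (s k), EuclideanDomain.gcdB (r k) (s k), ?_⟩
        have := EuclideanDomain.gcd_eq_gcd_ab (r k) (s k)
        apply mul_left_cancel₀ hg
        linear_combination -this - EuclideanDomain.gcdA (r k) (s k) * hp -
          EuclideanDomain.gcdB (r k) (s k) * hq
    obtain ⟨g, p, q, hg, hpq, hrk, hsk⟩ := hcop
    obtain ⟨a, b, hab⟩ := hpq
    have hcross : ∀ i, r i * q = s i * p := fun i => by
      apply mul_left_cancel₀ hg
      linear_combination hminor i k - r i * hsk + s i * hrk
    -- With `a * p + b * q = 1` and `r i * q = s i * p`, the only possible common factor is `a * r i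
    -- + b * s i`.
    refine ⟨p, q, fun i => a * r i + b * s i, ⟨a, b, hab⟩, fun i => ⟨?_, ?_⟩⟩
    · linear_combination -r i * hab + b * hcross i
    · linear_combination -s i * hab - a * hcross i

/-- Consecutive coordinates have the common ratio `p : q`. Bézout then extracts one factor of `p` or
`q` at a time. The end coordinates give `deg a + 2 deg p ≤ 3` and `deg b + 3 deg p ≤ 3`, and
likewise for `q`, whenever the factors are nonzero. -/
theorem exists_conic_cubic_factor [Fintype K] (hq : 7 ≤ Fintype.card K)
    (A₀ A₁ A₂ B₀ B₁ B₂ B₃ : K[X])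
    (hA₀ : A₀.natDegree ≤ 3) (hA₁ : A₁.natDegree ≤ 3) (hA₂ : A₂.natDegree ≤ 3)
    (hB₀ : B₀.natDegree ≤ 3) (hB₁ : B₁.natDegree ≤ 3) (hB₂ : B₂.natDegree ≤ 3)
    (hB₃ : B₃.natDegree ≤ 3)
    (h : ∀ θ : K, ∃ x y α β : K,
      (A₀.eval θ = α * x ^ 2 ∧ A₁.eval θ = α * (x * y) ∧ A₂.eval θ = α * y ^ 2) ∧
      B₀.eval θ = β * x ^ 3 ∧ B₁.eval θ = β * (x ^ 2 * y) ∧ B₂.eval θ = β * (x * y ^ 2) ∧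
      B₃.eval θ = β * y ^ 3) :
    ∃ p q a b : K[X],
      (A₀ = a * p ^ 2 ∧ A₁ = a * (p * q) ∧ A₂ = a * q ^ 2) ∧
      (B₀ = b * p ^ 3 ∧ B₁ = b * (p ^ 2 * q) ∧ B₂ = b * (p * q ^ 2) ∧ B₃ = b * q ^ 3) ∧
      p.natDegree ≤ 1 ∧ q.natDegree ≤ 1 ∧
        ((p.natDegree = 0 ∧ q.natDegree = 0) ∨ (a.natDegree ≤ 1 ∧ b.natDegree = 0)) := by
  -- The two rows list the pairs of consecutive coordinates of the conic and of the cubic; each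
  -- column is proportional to `(x, y)`.
  obtain ⟨p, q, m, ⟨c, d, hcd⟩, hm⟩ := exists_isCoprime_ratio hq ![A₀, A₁, B₀, B₁, B₂]
    ![A₁, A₂, B₁, B₂, B₃] (by intro i; fin_cases i <;> simpa) (by intro i; fin_cases i <;> simpa)
    (by
      intro θ
      obtain ⟨x, y, α, β, ⟨h1, h2, h3⟩, h4, h5, h6, h7⟩ := h θ
      refine ⟨x, y, ![α * x, α * y, β * x ^ 2, β * (x * y), β * y ^ 2], fun i => ?_⟩
      fin_cases i <;> simp [h1, h2, h3, h4, h5, h6, h7] <;> constructor <;> ring)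
  have e0 := hm 0
  have e1 := hm 1
  have e2 := hm 2
  have e3 := hm 3
  have e4 := hm 4
  simp only [Matrix.cons_val] at e0 e1 e2 e3 e4
  generalize m 0 = m0 at *
  generalize m 1 = m1 at *
  generalize m 2 = m2 at *
  generalize m 3 = m3 at *
  generalize m 4 = m4 at *
  obtain ⟨e0, f0⟩ := e0
  obtain ⟨e1, f1⟩ := e1
  obtain ⟨e2, f2⟩ := e2
  obtain ⟨e3, f3⟩ := e3
  obtain ⟨e4, f4⟩ := e4
  have k1 : p * m1 = q * m0 := e1.symm.trans f0
  have k3 : p * m3 = q * m2 := e3.symm.trans f2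
  have k4 : p * m4 = q * m3 := e4.symm.trans f3
  -- Coprimality of `p` and `q`: a pair proportional to `(p, q)` is a polynomial multiple of it.
  have key : ∀ u v : K[X], p * v = q * u → u = p * (c * u + d * v) ∧ v = q * (c * u + d * v) := by
    intro u v huv
    constructor
    · linear_combination -u * hcd - d * huv
    · linear_combination -v * hcd + c * huv
  obtain ⟨g0, g1⟩ := key m0 m1 k1
  obtain ⟨g2, g3⟩ := key m2 m3 k3
  obtain ⟨g3', g4⟩ := key m3 m4 k4
  set a := c * m0 + d * m1
  set k := c * m2 + d * m3
  set k' := c * m3 + d * m4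
  have hk : p * k' = q * k := by rw [← g3', ← g3]
  obtain ⟨g5, g6⟩ := key k k' hk
  set b := c * k + d * k'
  have hA : A₀ = a * p ^ 2 ∧ A₁ = a * (p * q) ∧ A₂ = a * q ^ 2 :=
    ⟨by rw [e0, g0]; ring, by rw [e1, g1]; ring, by rw [f1, g1]; ring⟩
  have hB : B₀ = b * p ^ 3 ∧ B₁ = b * (p ^ 2 * q) ∧ B₂ = b * (p * q ^ 2) ∧ B₃ = b * q ^ 3 :=
    ⟨by rw [e2, g2, g5]; ring, by rw [e3, g3, g5]; ring, by rw [e4, g4, g6]; ring,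
      by rw [f4, g4, g6]; ring⟩
  clear_value a k k' b
  have dega : ∀ f g : K[X], f ≠ 0 → g ≠ 0 → (g * f ^ 2).natDegree ≤ 3 →
      g.natDegree + 2 * f.natDegree ≤ 3 := by
    intro f g hf hg hfg
    rwa [natDegree_mul hg (pow_ne_zero _ hf), natDegree_pow] at hfg
  have degb : ∀ f g : K[X], f ≠ 0 → g ≠ 0 → (g * f ^ 3).natDegree ≤ 3 →
      g.natDegree + 3 * f.natDegree ≤ 3 := by
    intro f g hf hg hfg
    rwa [natDegree_mul hg (pow_ne_zero _ hf), natDegree_pow] at hfg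
  -- If `a = b = 0`, the coordinates do not bound the degrees of `p` and `q`, which are replaced by
  -- zero.
  by_cases hab : a = 0 ∧ b = 0
  · refine ⟨0, 0, 0, 0, ?_⟩
    simp [hA, hB, hab]
  · refine ⟨p, q, a, b, hA, hB, ?_⟩
    have hap := fun hp ha => dega p a hp ha (hA.1 ▸ hA₀)
    have haq := fun hp ha => dega q a hp ha (hA.2.2 ▸ hA₂)
    have hbp := fun hp ha => degb p b hp ha (hB.1 ▸ hB₀)
    have hbq := fun hp ha => degb q b hp ha (hB.2.2.2 ▸ hB₃)
    have zp : p = 0 → p.natDegree = 0 := fun h => by simp [h]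
    have zq : q = 0 → q.natDegree = 0 := fun h => by simp [h]
    have za : a = 0 → a.natDegree = 0 := fun h => by simp [h]
    have zb : b = 0 → b.natDegree = 0 := fun h => by simp [h]
    simp only [ne_eq] at hap haq hbp hbq
    clear * - hap haq hbp hbq zp zq za zb hab
    generalize p.natDegree = np at *
    generalize q.natDegree = nq at *
    generalize a.natDegree = na at *
    generalize b.natDegree = nb at *
    generalize (p = 0) = P at *
    generalize (q = 0) = Q at *
    by_cases hp : P <;> by_cases hq : Q <;> by_cases ha : a = 0 <;>
      by_cases hb : b = 0 <;>
      simp only [hp, hq, ha, hb, not_true_eq_false, not_false_eq_true, false_implies,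
        true_implies, and_self, and_true, true_and] at hap haq hbp hbq zp zq za zb hab ⊢ <;>
      omega

end Polynomial

/-! ### Twisted cubics on the scroll, in vector form. -/

section Cubic

variable {K : Type*} [Field K] {W : Type*} [AddCommGroup W] [Module K W]

/-- The coefficients of the cubic `x ↦ l(x) • c(x) + n(x)`, for the conic `c` with coefficients
`v`, the twisted cubic `n` with coefficients `w` and the linear form `l`. -/
def cubicVec (v : Fin 3 → W) (w : Fin 4 → W) (l : Fin 2 → K) : Fin 4 → W :=
  ![w 0 + l 0 • v 0, w 1 + l 0 • v 1 + l 1 • v 0, w 2 + l 0 • v 2 + l 1 • v 1, w 3 + l 1 • v 2]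

theorem nrcVec_cubicVec (v : Fin 3 → W) (w : Fin 4 → W) (l x : Fin 2 → K) :
    nrcVec (n := 3) (cubicVec v w l) x =
      (l 0 * x 0 + l 1 * x 1) • nrcVec (n := 2) v x + nrcVec (n := 3) w x := by
  rw [nrcVec_three, nrcVec_two, nrcVec_three]
  simp only [cubicVec, Matrix.cons_val]
  module

/-- The new coefficients differ from `w` by vectors in the span of `v`: a unipotent change of basis.
-/
theorem linearIndependent_elim_cubicVec {v : Fin 3 → W} {w : Fin 4 → W}
    (h : LinearIndependent K (Sum.elim v w)) (l : Fin 2 → K) :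
    LinearIndependent K (Sum.elim v (cubicVec v w l)) := by
  rw [Fintype.linearIndependent_iff] at h ⊢
  intro g hg
  let f : Fin 3 → K := ![g (.inl 0) + l 0 * g (.inr 0) + l 1 * g (.inr 1),
    g (.inl 1) + l 0 * g (.inr 1) + l 1 * g (.inr 2),
    g (.inl 2) + l 0 * g (.inr 2) + l 1 * g (.inr 3)]
  have h0 := h (Sum.elim f fun i => g (.inr i)) (by
    rw [← hg]
    simp only [Fintype.sum_sum_type, Sum.elim_inl, Sum.elim_inr, Fin.sum_univ_three,
      Fin.sum_univ_four, f, cubicVec, Matrix.cons_val]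
    module)
  have hr : ∀ i, g (.inr i) = 0 := fun i => h0 (.inr i)
  rintro (i | i)
  · have := h0 (.inl i)
    fin_cases i <;> simpa [f, hr] using this
  · exact hr i

theorem exists_polynomial_factor [Fintype K] (hq : 7 ≤ Fintype.card K) {v : Fin 3 → W}
    {w : Fin 4 → W} (b : Module.Basis (Fin 3 ⊕ Fin 4) K W) (hb : ⇑b = Sum.elim v w)
    {u : Fin 4 → W} (hu : ∀ θ : K, ∃ (y : Fin 2 → K) (α β : K),
      nrcVec (n := 3) u ![1, θ] = α • nrcVec (n := 2) v y + β • nrcVec (n := 3) w y) :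
    ∃ p q a k : Polynomial K, (∀ θ : K, nrcVec (n := 3) u ![1, θ] =
        a.eval θ • nrcVec (n := 2) v ![p.eval θ, q.eval θ] +
          k.eval θ • nrcVec (n := 3) w ![p.eval θ, q.eval θ]) ∧
      p.natDegree ≤ 1 ∧ q.natDegree ≤ 1 ∧
        ((p.natDegree = 0 ∧ q.natDegree = 0) ∨ (a.natDegree ≤ 1 ∧ k.natDegree = 0)) := by
  have hbv : ∀ i, v i = b (.inl i) := fun i => by rw [hb]; rfl
  have hbw : ∀ i, w i = b (.inr i) := fun i => by rw [hb]; rfl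
  let P : Fin 3 ⊕ Fin 4 → Polynomial K := fun s =>
    .C (b.repr (u 0) s) + .C (b.repr (u 1) s) * .X + .C (b.repr (u 2) s) * .X ^ 2 +
      .C (b.repr (u 3) s) * .X ^ 3
  have hP : ∀ s, (P s).natDegree ≤ 3 := fun s => by
    simp only [P]
    compute_degree
  have hev : ∀ s θ, (P s).eval θ = b.repr (nrcVec (n := 3) u ![1, θ]) s := fun s θ => by
    rw [nrcVec_three]
    simp only [P, map_add, map_smul, Finsupp.add_apply, Finsupp.smul_apply, smul_eq_mul,
      Polynomial.eval_add, Polynomial.eval_mul, Polynomial.eval_C, Polynomial.eval_pow,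
      Polynomial.eval_X, Matrix.cons_val]
    ring
  have hv : ∀ y (i : Fin 3), b.repr (nrcVec (n := 2) v y) (.inl i) =
      ![y 0 ^ 2, y 0 * y 1, y 1 ^ 2] i := fun y i => by
    rw [nrcVec_two]
    fin_cases i <;> simp [hbv]
  have hv' : ∀ (y : Fin 2 → K) (i : Fin 4), b.repr (nrcVec (n := 2) v y) (.inr i) = 0 := fun y i => by
    rw [nrcVec_two]
    simp [hbv]
  have hw : ∀ y (i : Fin 4), b.repr (nrcVec (n := 3) w y) (.inr i) =
      ![y 0 ^ 3, y 0 ^ 2 * y 1, y 0 * y 1 ^ 2, y 1 ^ 3] i := fun y i => by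
    rw [nrcVec_three]
    fin_cases i <;> simp [hbw]
  have hw' : ∀ (y : Fin 2 → K) (i : Fin 3), b.repr (nrcVec (n := 3) w y) (.inl i) = 0 := fun y i => by
    rw [nrcVec_three]
    simp [hbw]
  obtain ⟨p, q, a, k, ⟨a0, a1, a2⟩, ⟨k0, k1, k2, k3⟩, hdeg⟩ := exists_conic_cubic_factor hq
    (P (.inl 0)) (P (.inl 1)) (P (.inl 2)) (P (.inr 0)) (P (.inr 1)) (P (.inr 2)) (P (.inr 3))
    (hP _) (hP _) (hP _) (hP _) (hP _) (hP _) (hP _) (by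
      intro θ
      obtain ⟨y, α, β, h⟩ := hu θ
      refine ⟨y 0, y 1, α, β, ?_⟩
      simp [hev, h, hv, hv', hw, hw'])
  refine ⟨p, q, a, k, fun θ => b.ext_elem fun s => ?_, hdeg⟩
  rw [← hev]
  rcases s with i | i <;> fin_cases i <;>
    simp [a0, a1, a2, k0, k1, k2, k3, hv, hv', hw, hw']

theorem nrcVec_zero {n : ℕ} (hn : n ≠ 0) (v : Fin (n + 1) → W) : nrcVec v (0 : Fin 2 → K) = 0 := by
  have := nrcVec_smul v (0 : K) 0
  simpa [hn] using this

theorem nrcVec_smul_coeff {n : ℕ} (k : K) (v : Fin (n + 1) → W) (x : Fin 2 → K) :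
    nrcVec (fun i => k • v i) x = k • nrcVec v x := by
  simp only [nrcVec, Finset.smul_sum, smul_smul, mul_comm]

/-- If `p` and `q` were constant, the whole curve would lie in the span of two vectors, while `u`
spans dimension 4. In the other case the degree bounds turn `p, q` into a matrix and `a` into a
linear form. -/
theorem exists_linear_factor [Fintype K] (hq : 7 ≤ Fintype.card K) {v : Fin 3 → W}
    {w : Fin 4 → W} (b : Module.Basis (Fin 3 ⊕ Fin 4) K W) (hb : ⇑b = Sum.elim v w)
    {u : Fin 4 → W} (hu : LinearIndependent K u) (huV : ∀ θ : K, ∃ (y : Fin 2 → K) (α β : K),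
      nrcVec (n := 3) u ![1, θ] = α • nrcVec (n := 2) v y + β • nrcVec (n := 3) w y) :
    ∃ (l : Fin 2 → K) (k : K) (A : Matrix (Fin 2) (Fin 2) K), ∀ x, nrcVec (n := 3) u x =
      (l 0 * x 0 + l 1 * x 1) • nrcVec (n := 2) v (A.mulVec x) +
        k • nrcVec (n := 3) w (A.mulVec x) := by
  obtain ⟨p, q, a, k, h, hp, hq', hdeg⟩ := exists_polynomial_factor hq b hb huV
  rcases hdeg with ⟨hp0, hq0⟩ | ⟨ha, hk⟩
  · exfalso
    obtain ⟨p, rfl⟩ := Polynomial.natDegree_eq_zero.1 hp0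
    obtain ⟨q, rfl⟩ := Polynomial.natDegree_eq_zero.1 hq0
    simp only [Polynomial.eval_C] at h
    let z : Fin 2 → W := ![nrcVec (n := 2) v ![p, q], nrcVec (n := 3) w ![p, q]]
    have hmem : ∀ i, u i ∈ Submodule.span K (Set.range z) := by
      refine mem_of_nrcVec_mem (n := 3) (by omega) fun θ => ?_
      rw [h θ]
      exact Submodule.add_mem _ (Submodule.smul_mem _ _ (Submodule.subset_span ⟨0, rfl⟩))
        (Submodule.smul_mem _ _ (Submodule.subset_span ⟨1, rfl⟩))
    have hle : Submodule.span K (Set.range u) ≤ Submodule.span K (Set.range z) :=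
      Submodule.span_le.2 (Set.range_subset_iff.2 hmem)
    have : FiniteDimensional K (Submodule.span K (Set.range z)) :=
      FiniteDimensional.span_of_finite K (Set.finite_range _)
    have h1 := (Submodule.finrank_mono hle).trans (finrank_range_le_card z)
    rw [finrank_span_eq_card hu] at h1
    simp only [Fintype.card_fin] at h1
    omega
  · obtain ⟨p₁, p₀, rfl⟩ := Polynomial.exists_eq_X_add_C_of_natDegree_le_one hp
    obtain ⟨q₁, q₀, rfl⟩ := Polynomial.exists_eq_X_add_C_of_natDegree_le_one hq'
    obtain ⟨a₁, a₀, rfl⟩ := Polynomial.exists_eq_X_add_C_of_natDegree_le_one ha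
    obtain ⟨k, rfl⟩ := Polynomial.natDegree_eq_zero.1 hk
    let l : Fin 2 → K := ![a₀, a₁]
    let A : Matrix (Fin 2) (Fin 2) K := ![![p₀, p₁], ![q₀, q₁]]
    refine ⟨l, k, A, ?_⟩
    let u' : Fin 4 → W := fun i => (mulLinear l (A 0) (A 0) i • v 0 +
      mulLinear l (A 0) (A 1) i • v 1 + mulLinear l (A 1) (A 1) i • v 2) + k • nrcComp w A i
    have hu' : ∀ x, nrcVec (n := 3) u' x =
        (l 0 * x 0 + l 1 * x 1) • nrcVec (n := 2) v (A.mulVec x) +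
          k • nrcVec (n := 3) w (A.mulVec x) := by
      intro x
      simp only [u']
      rw [nrcVec_add (n := 3), nrcVec_add (n := 3), nrcVec_add (n := 3)]
      simp only [nrcVec_mulLinear_smul]
      rw [nrcVec_smul_coeff (n := 3), nrcVec_nrcComp, nrcVec_two]
      congr 1
      simp only [Matrix.mulVec, dotProduct, Fin.sum_univ_two]
      module
    -- Agreement at the affine parameters forces equal coefficients, which yields the identity at
    -- infinity too.
    have huu : u = u' := by
      refine eq_of_nrcVec_eq (K := K) (n := 3) (by omega) fun θ => ?_
      rw [h θ, hu']
      have hA : A.mulVec ![1, θ] = ![p₁ * θ + p₀, q₁ * θ + q₀] := by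
        ext i
        fin_cases i <;> simp [A, Matrix.mulVec, dotProduct] <;> ring
      simp only [hA, Polynomial.eval_add, Polynomial.eval_mul, Polynomial.eval_C,
        Polynomial.eval_X, l, Matrix.cons_val, mul_one, add_comm]
    rw [huu]
    exact hu'

/-- A twisted cubic has no zero vector among its values. A kernel vector of `A`, or a zero of `l`
when `k = 0`, would produce one. -/
theorem exists_eq_cubicVec [Fintype K] (hq : 7 ≤ Fintype.card K) {v : Fin 3 → W}
    {w : Fin 4 → W} (b : Module.Basis (Fin 3 ⊕ Fin 4) K W) (hb : ⇑b = Sum.elim v w)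
    {u : Fin 4 → W} (hu : LinearIndependent K u) (huV : ∀ θ : K, ∃ (y : Fin 2 → K) (α β : K),
      nrcVec (n := 3) u ![1, θ] = α • nrcVec (n := 2) v y + β • nrcVec (n := 3) w y) :
    ∃ (l : Fin 2 → K) (k : K) (A : Matrix.GeneralLinearGroup (Fin 2) K), k ≠ 0 ∧
      ∀ x, nrcVec (n := 3) u x = k • nrcVec (n := 3) (cubicVec v w l) (A.1.mulVec x) := by
  obtain ⟨l, k, A, h⟩ := exists_linear_factor hq b hb hu huV
  have hA : A.det ≠ 0 := by
    intro hA
    obtain ⟨x, hx, hx0⟩ := Matrix.exists_mulVec_eq_zero_iff.2 hA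
    refine nrcVec_ne_zero (n := 3) hu hx ?_
    rw [h, hx0, nrcVec_zero (n := 2) two_ne_zero, nrcVec_zero (n := 3) three_ne_zero]
    simp
  have hk : k ≠ 0 := by
    rintro rfl
    by_cases hl : l = 0
    · refine nrcVec_ne_zero (n := 3) hu (x := ![1, 0])
        (fun h => one_ne_zero (congrFun h 0)) ?_
      rw [h, hl]
      simp
    -- This is the zero of the linear form `l`.
    · refine nrcVec_ne_zero (n := 3) hu (x := ![-l 1, l 0]) (fun h => hl ?_) ?_
      · ext i
        fin_cases i
        · simpa using congrFun h 1
        · simpa using congrFun h 0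
      · rw [h]
        simp [mul_comm]
  -- The form `l` is rewritten in the parameter `A x` and divided by `k`, so that the cubic part has
  -- coefficient 1.
  refine ⟨k⁻¹ • Matrix.vecMul l A⁻¹, k, Matrix.GeneralLinearGroup.mkOfDetNeZero A hA, hk,
    fun x => ?_⟩
  have hval : (Matrix.GeneralLinearGroup.mkOfDetNeZero A hA).1 = A := rfl
  have hlx : dotProduct (Matrix.vecMul l A⁻¹) (A.mulVec x) = dotProduct l x := by
    rw [← Matrix.dotProduct_mulVec, Matrix.mulVec_mulVec,
      Matrix.nonsing_inv_mul _ (isUnit_iff_ne_zero.2 hA), Matrix.one_mulVec]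
  simp only [dotProduct, Fin.sum_univ_two] at hlx
  rw [hval, nrcVec_cubicVec, h, smul_add, smul_smul, ← hlx]
  congr 2
  simp only [Pi.smul_apply, smul_eq_mul]
  field_simp

end Cubic

/-! ### From vectors to the scroll and its directrices. -/

section Scroll

variable {K : Type*} [Field K] {W : Type*} [AddCommGroup W] [Module K W]

/-- In suitable coordinates, the projectivity that rules a scroll preserves the parameter. -/
theorem IsScroll.exists_coordinates [Fintype K] (hq : 7 ≤ Fintype.card K) {V C N : Set (ℙ K W)}
    {φ : C → N} (hV : IsScroll V C N φ) :
    ∃ (v : Fin 3 → W) (w : Fin 4 → W) (hv : LinearIndependent K v) (hw : LinearIndependent K w),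
      LinearIndependent K (Sum.elim v w) ∧ C = Set.range (nrcPoint (n := 2) v hv) ∧
      ∀ (P : C) θ, (P : ℙ K W) = nrcPoint (n := 2) v hv θ →
        (φ P : ℙ K W) = nrcPoint (n := 3) w hw θ := by
  obtain ⟨v, hv, w, hw, g, hC, hN, hφ⟩ := hV.projectivity
  have hd := hV.disjoint
  rw [hC, hN, disjoint_span_range_nrcPoint_iff (by omega) (by omega)] at hd
  induction g using Matrix.ProjGenLinGroup.induction_on with
  | mk A =>
    have hw' := linearIndependent_nrcComp (by omega) hw A
    -- The matrix representing the projectivity is moved into the coefficients of the cubic, whose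
    -- span does not grow.
    refine ⟨v, nrcComp w A.1, hv, hw', ?_, hC, fun P θ hP => ?_⟩
    · rw [linearIndependent_sum] at hd ⊢
      refine ⟨hv, hw', hd.2.2.mono_right ?_⟩
      simp only [Sum.elim_comp_inr]
      rw [Submodule.span_le]
      rintro _ ⟨i, rfl⟩
      have hm : ∀ i, w i ∈ Submodule.span K (Set.range w) := fun i =>
        Submodule.subset_span ⟨i, rfl⟩
      exact add_mem (add_mem (add_mem (Submodule.smul_mem _ _ (hm _))
        (Submodule.smul_mem _ _ (hm _))) (Submodule.smul_mem _ _ (hm _)))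
        (Submodule.smul_mem _ _ (hm _))
    · rw [hφ P θ hP]
      induction θ using Projectivization.ind with
      | h x hx =>
        rw [Projectivization.PGL.mk_smul_mk, nrcPoint_mk, nrcPoint_mk]
        congr 1
        rw [nrcVec_nrcComp]
        rfl

theorem mem_generator_iff {C N : Set (ℙ K W)} (φ : C → N) (P : C) {c d : W} (hc : c ≠ 0)
    (hd : d ≠ 0) (hP : (P : ℙ K W) = Projectivization.mk K c hc)
    (hφ : (φ P : ℙ K W) = Projectivization.mk K d hd) {z : W} (hz : z ≠ 0) :
    Projectivization.mk K z hz ∈ generator φ P ↔ ∃ α β : K, α • c + β • d = z := by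
  rw [generator, hP, hφ]
  exact mk_mem_span_pair_iff hc hd hz

theorem mem_scroll_iff {V C N : Set (ℙ K W)} {φ : C → N} (hV : V = ⋃ P : C, generator φ P)
    {v : Fin 3 → W} {w : Fin 4 → W} (hv : LinearIndependent K v) (hw : LinearIndependent K w)
    (hC : C = Set.range (nrcPoint (n := 2) v hv))
    (hφ : ∀ (P : C) θ, (P : ℙ K W) = nrcPoint (n := 2) v hv θ →
      (φ P : ℙ K W) = nrcPoint (n := 3) w hw θ) {z : W} (hz : z ≠ 0) :
    Projectivization.mk K z hz ∈ V ↔ ∃ x : Fin 2 → K, x ≠ 0 ∧ ∃ α β : K,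
      α • nrcVec (n := 2) v x + β • nrcVec (n := 3) w x = z := by
  rw [hV, Set.mem_iUnion]
  constructor
  · rintro ⟨P, h⟩
    have hP : (P : ℙ K W) ∈ Set.range (nrcPoint (n := 2) v hv) := hC ▸ P.2
    obtain ⟨x, hx, hPx⟩ := exists_eq_mk_nrcVec hP
    exact ⟨x, hx, (mem_generator_iff φ P _ _ hPx
      (hφ P (Projectivization.mk K x hx) hPx) hz).1 h⟩
  · rintro ⟨x, hx, h⟩
    let P : C := ⟨nrcPoint (n := 2) v hv (Projectivization.mk K x hx), by rw [hC]; exact ⟨_, rfl⟩⟩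
    exact ⟨P, (mem_generator_iff φ P (nrcVec_ne_zero (n := 2) hv hx)
      (nrcVec_ne_zero (n := 3) hw hx) rfl (hφ P (Projectivization.mk K x hx) rfl) hz).2 h⟩

/-- The twisted cubic with coefficients `cubicVec v w l`. -/
def cubicCurve {v : Fin 3 → W} {w : Fin 4 → W} (h : LinearIndependent K (Sum.elim v w))
    (l : Fin 2 → K) : Set (ℙ K W) :=
  Set.range (nrcPoint (n := 3) (cubicVec v w l)
    (linearIndependent_sum.1 (linearIndependent_elim_cubicVec h l)).2.1)

theorem isTwistedCubic_cubicCurve {v : Fin 3 → W} {w : Fin 4 → W}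
    (h : LinearIndependent K (Sum.elim v w)) (l : Fin 2 → K) :
    IsTwistedCubic (cubicCurve h l) :=
  ⟨_, _, rfl⟩

/-- At a common point with parameters `x` and `y`, the component in the span of `w` forces `y = s •
x` and scaling factor `t` with `t * s ^ 3 = 1`. The component in the span of `v` carries the same
factor `t * s ^ 3`, so the two forms agree at `x`. -/
theorem cubicCurve_injective {v : Fin 3 → W} {w : Fin 4 → W}
    (h : LinearIndependent K (Sum.elim v w)) : Function.Injective (cubicCurve h) := by
  intro l m hlm
  obtain ⟨hv, hw, hd⟩ := linearIndependent_sum.1 h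
  simp only [Sum.elim_comp_inl, Sum.elim_comp_inr] at hv hw hd
  have key : ∀ x : Fin 2 → K, x ≠ 0 → l 0 * x 0 + l 1 * x 1 = m 0 * x 0 + m 1 * x 1 := by
    intro x hx
    have hx' : nrcPoint (n := 3) (cubicVec v w l)
        (linearIndependent_sum.1 (linearIndependent_elim_cubicVec h l)).2.1
        (Projectivization.mk K x hx) ∈ cubicCurve h m := by
      rw [← hlm]
      exact ⟨_, rfl⟩
    obtain ⟨y, hy, hxy⟩ := exists_eq_mk_nrcVec hx'
    obtain ⟨t, ht⟩ := (Projectivization.mk_eq_mk_iff' _ _ _ _ _).1 hxy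
    rw [nrcVec_cubicVec, nrcVec_cubicVec, smul_add, smul_smul] at ht
    obtain ⟨h2, h3⟩ := eq_and_eq_of_add_eq_of_disjoint hd
      (Submodule.smul_mem _ _ (nrcVec_mem_span (n := 2) v y))
      (Submodule.smul_mem _ _ (nrcVec_mem_span (n := 2) v x))
      (Submodule.smul_mem _ _ (nrcVec_mem_span (n := 3) w y))
      (nrcVec_mem_span (n := 3) w x) ht
    have hpt : nrcPoint (n := 3) w hw (Projectivization.mk K y hy) =
        nrcPoint (n := 3) w hw (Projectivization.mk K x hx) :=
      ((Projectivization.mk_eq_mk_iff' _ _ _ _ _).2 ⟨t, h3⟩).symm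
    obtain ⟨s, rfl⟩ :=
      (Projectivization.mk_eq_mk_iff' _ _ _ _ _).1 (nrcPoint_injective three_ne_zero hw hpt)
    have hts : t * s ^ 3 = 1 := by
      rw [nrcVec_smul, smul_smul] at h3
      exact smul_left_injective K (nrcVec_ne_zero (n := 3) hw hx) (h3.trans (one_smul K _).symm)
    rw [nrcVec_smul, smul_smul] at h2
    have := smul_left_injective K (nrcVec_ne_zero (n := 2) hv hx) h2
    simp only [Pi.smul_apply, smul_eq_mul] at this
    linear_combination (m 0 * x 0 + m 1 * x 1) * hts - this
  have k0 := key ![1, 0] (fun h => one_ne_zero (congrFun h 0))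
  have k1 := key ![0, 1] (fun h => one_ne_zero (congrFun h 1))
  ext i
  fin_cases i
  · simpa using k0
  · simpa using k1

theorem cubicCurve_subset {V C N : Set (ℙ K W)} {φ : C → N} (hV : V = ⋃ P : C, generator φ P)
    {v : Fin 3 → W} {w : Fin 4 → W} (hv : LinearIndependent K v) (hw : LinearIndependent K w)
    (h : LinearIndependent K (Sum.elim v w)) (hC : C = Set.range (nrcPoint (n := 2) v hv))
    (hφ : ∀ (P : C) θ, (P : ℙ K W) = nrcPoint (n := 2) v hv θ →
      (φ P : ℙ K W) = nrcPoint (n := 3) w hw θ) (l : Fin 2 → K) : cubicCurve h l ⊆ V := by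
  intro Q hQ
  obtain ⟨x, hx, rfl⟩ := exists_eq_mk_nrcVec hQ
  rw [mem_scroll_iff hV hv hw hC hφ]
  exact ⟨x, hx, l 0 * x 0 + l 1 * x 1, 1, by rw [one_smul, nrcVec_cubicVec]⟩

theorem eq_cubicCurve_of_subset [Fintype K] (hq : 7 ≤ Fintype.card K)
    (hW : Module.finrank K W = 7) {V C N : Set (ℙ K W)} {φ : C → N}
    (hV : V = ⋃ P : C, generator φ P)
    {v : Fin 3 → W} {w : Fin 4 → W} (hv : LinearIndependent K v) (hw : LinearIndependent K w)
    (h : LinearIndependent K (Sum.elim v w)) (hC : C = Set.range (nrcPoint (n := 2) v hv))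
    (hφ : ∀ (P : C) θ, (P : ℙ K W) = nrcPoint (n := 2) v hv θ →
      (φ P : ℙ K W) = nrcPoint (n := 3) w hw θ) {T : Set (ℙ K W)} (hT : IsTwistedCubic T)
    (hTV : T ⊆ V) : ∃ l, T = cubicCurve h l := by
  obtain ⟨u, hu, rfl⟩ := hT
  let b := basisOfLinearIndependentOfCardEqFinrank h (by simp [hW])
  obtain ⟨l, k, A, hk, hA⟩ := exists_eq_cubicVec hq b
    (coe_basisOfLinearIndependentOfCardEqFinrank h _) hu (fun θ => by
      have hθ : (![1, θ] : Fin 2 → K) ≠ 0 := fun h => one_ne_zero (congrFun h 0)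
      obtain ⟨x, -, α, β, hx⟩ := (mem_scroll_iff hV hv hw hC hφ (nrcVec_ne_zero hu hθ)).1
        (hTV ⟨Projectivization.mk K ![1, θ] hθ, rfl⟩)
      exact ⟨x, α, β, hx.symm⟩)
  have hpt : ∀ x (hx : x ≠ 0) (hAx : A.1.mulVec x ≠ 0),
      nrcPoint (n := 3) u hu (Projectivization.mk K x hx) = nrcPoint (n := 3) (cubicVec v w l)
        (linearIndependent_sum.1 (linearIndependent_elim_cubicVec h l)).2.1
        (Projectivization.mk K (A.1.mulVec x) hAx) := fun x hx hAx =>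
    (Projectivization.mk_eq_mk_iff' _ _ _ _ _).2 ⟨k, (hA x).symm⟩
  have hinv : ∀ (B : Matrix.GeneralLinearGroup (Fin 2) K) (x : Fin 2 → K),
      B⁻¹.1.mulVec (B.1.mulVec x) = x := fun B x => by
    rw [Matrix.mulVec_mulVec, ← Units.val_mul, inv_mul_cancel, Units.val_one, Matrix.one_mulVec]
  have hne : ∀ (B : Matrix.GeneralLinearGroup (Fin 2) K) (x : Fin 2 → K), x ≠ 0 →
      B.1.mulVec x ≠ 0 := fun B x hx h0 => hx (by rw [← hinv B x, h0, Matrix.mulVec_zero])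
  refine ⟨l, Set.Subset.antisymm ?_ ?_⟩
  · rintro _ ⟨Q, rfl⟩
    induction Q using Projectivization.ind with
    | h x hx => exact ⟨_, (hpt x hx (hne A x hx)).symm⟩
  · rintro _ ⟨Q, rfl⟩
    induction Q using Projectivization.ind with
    | h x hx =>
      have h1 : A.1.mulVec (A⁻¹.1.mulVec x) = x := by simpa using hinv A⁻¹ x
      refine ⟨Projectivization.mk K (A⁻¹.1.mulVec x) (hne _ x hx), ?_⟩
      rw [hpt _ _ (by rwa [h1])]
      congr 2

/-- The point `l(x) • c(x) + n(x)` spans with `c(x)` the same line as `n(x)` does, so matching equal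
parameters keeps every generator. -/
theorem exists_isScroll_cubicCurve [Fintype K] (hq : 7 ≤ Fintype.card K)
    {V C N : Set (ℙ K W)} {φ : C → N} (hV : V = ⋃ P : C, generator φ P)
    {v : Fin 3 → W} {w : Fin 4 → W} (hv : LinearIndependent K v) (hw : LinearIndependent K w)
    (h : LinearIndependent K (Sum.elim v w)) (hC : C = Set.range (nrcPoint (n := 2) v hv))
    (hφ : ∀ (P : C) θ, (P : ℙ K W) = nrcPoint (n := 2) v hv θ →
      (φ P : ℙ K W) = nrcPoint (n := 3) w hw θ) (l : Fin 2 → K) :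
    ∃ ψ : C → cubicCurve h l, IsScroll V C (cubicCurve h l) ψ ∧
      ∀ P, generator ψ P = generator φ P := by
  have hpar : ∀ P : C, ∃ θ, nrcPoint (n := 2) v hv θ = P := fun P => by
    have hP : (P : ℙ K W) ∈ Set.range (nrcPoint (n := 2) v hv) := hC ▸ P.2
    exact hP
  choose θ hθ using hpar
  have hl := linearIndependent_elim_cubicVec h l
  have hu : LinearIndependent K (cubicVec v w l) := (linearIndependent_sum.1 hl).2.1
  let ψ : C → cubicCurve h l := fun P => ⟨nrcPoint (n := 3) (cubicVec v w l) hu (θ P), _, rfl⟩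
  have hψ : ∀ (P : C) η, (P : ℙ K W) = nrcPoint (n := 2) v hv η →
      (ψ P : ℙ K W) = nrcPoint (n := 3) (cubicVec v w l) hu η := by
    intro P η hP
    have : θ P = η := nrcPoint_injective two_ne_zero hv ((hθ P).trans hP)
    rw [← this]
  have hgen : ∀ P, generator ψ P = generator φ P := by
    intro P
    have hP : (P : ℙ K W) ∈ Set.range (nrcPoint (n := 2) v hv) := hC ▸ P.2
    obtain ⟨x, hx, hPx⟩ := exists_eq_mk_nrcVec hP
    ext Q
    induction Q using Projectivization.ind with
    | h z hz =>
      rw [mem_generator_iff ψ P _ _ hPx (hψ P (Projectivization.mk K x hx) hPx) hz,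
        mem_generator_iff φ P _ _ hPx (hφ P (Projectivization.mk K x hx) hPx) hz]
      rw [nrcVec_cubicVec]
      constructor
      · rintro ⟨α, β, rfl⟩
        exact ⟨α + β * (l 0 * x 0 + l 1 * x 1), β, by module⟩
      · rintro ⟨α, β, rfl⟩
        exact ⟨α - β * (l 0 * x 0 + l 1 * x 1), β, by module⟩
  refine ⟨ψ, ⟨⟨v, hv, hC⟩, isTwistedCubic_cubicCurve h l, ?_, ?_, ?_⟩, hgen⟩
  · rw [hC]
    exact (disjoint_span_range_nrcPoint_iff (by omega) (by omega) hv hu).2 hl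
  · exact ⟨v, hv, _, hu, 1, hC, rfl, fun P η hP => by rw [one_smul]; exact hψ P η hP⟩
  · rw [hV]
    simp only [hgen]

end Scroll

end QuinticScroll

/-! ### The count and the directrix property. -/

theorem mainTheorem4 {K : Type*} [Field K] [Fintype K] (hq : 6 ≤ Fintype.card K)
    (V C N : Set (ℙ K (Fin 7 → K))) (φ : C → N) (hV : QuinticScroll.IsScroll V C N φ) :
    {T : Set (ℙ K (Fin 7 → K)) | QuinticScroll.IsTwistedCubic T ∧ T ⊆ V}.ncard =
        Fintype.card K ^ 2 ∧
      ∀ T : Set (ℙ K (Fin 7 → K)), QuinticScroll.IsTwistedCubic T → T ⊆ V →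
        ∃ ψ : C → T, QuinticScroll.IsScroll V C T ψ ∧
          ∀ P : C, QuinticScroll.generator ψ P = QuinticScroll.generator φ P := by
  have hq' := QuinticScroll.seven_le_card hq
  obtain ⟨v, w, hv, hw, h, hC, hφ⟩ := hV.exists_coordinates hq'
  have hcubic : ∀ T, QuinticScroll.IsTwistedCubic T → T ⊆ V →
      ∃ l, T = QuinticScroll.cubicCurve h l := fun T hT hTV =>
    QuinticScroll.eq_cubicCurve_of_subset hq' (by simp) hV.eq_union hv hw h hC hφ hT hTV
  constructor
  · have hset : {T : Set (ℙ K (Fin 7 → K)) | QuinticScroll.IsTwistedCubic T ∧ T ⊆ V} =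
        Set.range (QuinticScroll.cubicCurve h) := by
      ext T
      constructor
      · rintro ⟨hT, hTV⟩
        obtain ⟨l, rfl⟩ := hcubic T hT hTV
        exact ⟨l, rfl⟩
      · rintro ⟨l, rfl⟩
        exact ⟨QuinticScroll.isTwistedCubic_cubicCurve h l,
          QuinticScroll.cubicCurve_subset hV.eq_union hv hw h hC hφ l⟩
    rw [hset, ← Set.image_univ, Set.ncard_image_of_injective _
      (QuinticScroll.cubicCurve_injective h), Set.ncard_univ, Nat.card_eq_fintype_card]
    simp
  · intro T hT hTV
    obtain ⟨l, rfl⟩ := hcubic T hT hTV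
    exact QuinticScroll.exists_isScroll_cubicCurve hq' hV.eq_union hv hw h hC hφ l
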